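/- Let $\mathcal C$ be a category with finite limits (for instance a topos), let $k$ be a commutative ring, and let $R$ be a commutative $k$-algebra object of $\mathcal C$; write $R(T)=\mathrm{Hom}(T,R)$ for the $k$-algebra of elements of $R$ at stage $T$. A Weil algebra is a commutative $k$-algebra $W$ that is free of finite rank as a $k$-module and has an augmentation $W\to k$ with nilpotent kernel; $\mathrm{Spec}_R W$ denotes the object representing $T\mapsto\mathrm{Hom}_{k\text{-alg}}(W,R(T))$, and such objects are called small. Assume the general Kock–Lawvere axiom: for every Weil algebra $W$ and every object $T$, the canonical map $R(T)\otimes_k W\to R(T\times \mathrm{Spec}_R W)$ is bijective. An object $X$ perceives a cocone $(F_j\to P)_j$ as a colimit if for every object $T$ the functor $\mathrm{Hom}(T\times -,X)$ turns it into a limit cone of sets (that is, $X^{(-)}$ turns it into a limit, when exponentials exist). An object $M$ is microlinear if it perceives as a colimit every finite cocone of small objects (with small vertex) that $R$ perceives as a colimit. Let $M$ be microlinear. Below, the internal language of $\mathcal C$ is used: maps and elements are taken at an arbitrary stage $A$, so that a map $Y\to Z$ at stage $A$ is a morphism $A\times Y\to Z$, and $D\to M^M$ stands for $A\times M\times D\to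 M$. Put $D=\{d\in R: d^2=0\}$, $D(2)=\{(d_1,d_2)\in D^2: d_1d_2=0\}$ and $E=\{(d_1,d_2,d_3)\in D^3: d_1d_3=d_2d_3=0\}$. A vector field on $M$ is a map $X:D\to M^M$, $d\mapsto X_d$, with $X_0=\mathrm{id}_M$. The zero vector field is $d\mapsto \mathrm{id}_M$. The sum of two vector fields $X,Y$ is $(X+Y)_d=\ell(d,d)$, where $\ell:D(2)\to M^M$ is the unique map with $\ell(d,0)=X_d$ and $\ell(0,d)=Y_d$. The Lie bracket $[X,Y]$ is the strong difference of the maps $(d_1,d_2)\mapsto Y_{d_2}\circ X_{d_1}$ and $(d_1,d_2)\mapsto X_{d_1}\circ Y_{d_2}$ on $D^2$, that is, $[X,Y]_d=n(0,0,d)$, where $n:E\to M^M$ is the unique map with $n(d_1,d_2,d_1d_2)=Y_{d_2}\circ X_{d_1}$ and $n(d_1,d_2,0)=X_{d_1}\circ Y_{d_2}$ for all $(d_1,d_2)\in D^2$. Then for all vector fields $X_1,X_2,X_3,X_4$ on $M$ the sum of $[X_a,[X_b,[X_c,X_d]]]$ over the twelve even permutations $(a,b,c,d)$ of $(1,2,3,4)$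 vanishes: $$\begin{aligned} &[X_1,[X_2,[X_3,X_4]]]+[X_1,[X_3,[X_4,X_2]]]+[X_1,[X_4,[X_2,X_3]]]\\ {}+{}&[X_2,[X_1,[X_4,X_3]]]+[X_2,[X_3,[X_1,X_4]]]+[X_2,[X_4,[X_3,X_1]]]\\ {}+{}&[X_3,[X_1,[X_2,X_4]]]+[X_3,[X_2,[X_4,X_1]]]+[X_3,[X_4,[X_1,X_2]]]\\ {}+{}&[X_4,[X_1,[X_3,X_2]]]+[X_4,[X_2,[X_1,X_3]]]+[X_4,[X_3,[X_2,X_1]]]=0 . \end{aligned}$$ -/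

import Mathlib

/-!
# Synthetic differential geometry, interpreted in a category with finite limits

Synthetic differential geometry is the internal mathematics of a category `C` with finite limits
(usually a topos) that carries a commutative ring object `R`, the line. A statement of its internal
language is read externally through generalized elements: an element of `X` at stage `T` is a
morphism `T ⟶ X`, a map `X → Y` at stage `T` is a morphism `T ⊗ X ⟶ Y` (where `⊗` is the cartesian
product), and a universally quantified statement is asserted at every stage. By currying, a
morphism `T ⊗ X ⟶ Y` is the same thing as an element `T ⟶ Y ^ X` of the exponential whenever that
exists, so that exponentials are not needed to state anything below.
-/

open CategoryTheory MonoidalCategory CartesianMonoidalCategory Limits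
open scoped CommRingObj TensorProduct

universe w v u

namespace SDG

noncomputable section

section Base

variable {C : Type u} [Category.{v} C] [CartesianMonoidalCategory C] [BraidedCategory C]

/-- Restriction of functions along `f : B ⟶ A`, a ring homomorphism. -/
def restr {R : C} [CommRingObj R] {A B : C} (f : B ⟶ A) : (A ⟶ R) →+* (B ⟶ R) where
  toFun r := f ≫ r
  map_zero' := AddMonObj.comp_zero f
  map_one' := MonObj.comp_one f
  map_add' := AddMonObj.comp_add f
  map_mul' := MonObj.comp_mul f

/-- A `k`-algebra structure on the commutative ring object `R`, for an (external) commutative ring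
`k`: a ring homomorphism from `k` to the global elements of `R`. Every `R` has one for `k = ℤ` and
one for `k = (𝟙_ C ⟶ R)`. -/
class AlgebraObj (k : Type w) [CommRing k] (R : C) [CommRingObj R] where
  /-- The structure map into the ring of global elements. -/
  structureMap : k →+* (𝟙_ C ⟶ R)

/-- The elements of `R` at stage `A` form a `k`-algebra. -/
instance homAlgebra (k : Type w) [CommRing k] (R : C) [CommRingObj R] [AlgebraObj k R] (A : C) :
    Algebra k (A ⟶ R) :=
  ((restr (toUnit A)).comp (AlgebraObj.structureMap (k := k) (R := R))).toAlgebra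

/-- Restriction of functions along `f : B ⟶ A`, a homomorphism of `k`-algebras. -/
def pull (k : Type w) [CommRing k] {R : C} [CommRingObj R] [AlgebraObj k R] {A B : C}
    (f : B ⟶ A) : (A ⟶ R) →ₐ[k] (B ⟶ R) where
  __ := restr f
  commutes' c := by
    change f ≫ toUnit A ≫ _ = toUnit B ≫ _
    rw [← Category.assoc, comp_toUnit]

end Base

/-- `W` is a Weil algebra over `k`: it is free of finite rank as a `k`-module, and it has an
augmentation `W → k` whose kernel is a nilpotent ideal. -/
structure IsWeilAlgebra (k : Type w) [CommRing k] (W : Type w) [CommRing W] [Algebra k W] :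
    Prop where
  free : Module.Free k W
  finite : Module.Finite k W
  exists_augmentation : ∃ ε : W →ₐ[k] k, IsNilpotent (RingHom.ker ε)

section Objects

variable {C : Type u} [Category.{v} C] [CartesianMonoidalCategory C] [BraidedCategory C]
variable (k : Type w) [CommRing k] (R : C) [CommRingObj R] [AlgebraObj k R]

/-- `S`, with the universal point `g`, is the object `Spec_R W` of `k`-algebra homomorphisms from
`W` to `R`: the elements of `S` at stage `A` are, by way of `g`, the `k`-algebra homomorphisms from
`W` to the elements of `R` at stage `A`. For `W = k[x₁, …, xₙ] / (f₁, …, fₘ)` it is the object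
`{x ∈ Rⁿ | f₁ x = … = fₘ x = 0}`. -/
def IsSpec (W : Type w) [CommRing W] [Algebra k W] (S : C) (g : W →ₐ[k] (S ⟶ R)) : Prop :=
  ∀ (A : C) (φ : W →ₐ[k] (A ⟶ R)), ∃! f : A ⟶ S, (pull k f).comp g = φ

/-- The small (infinitesimal) objects: the spectra `Spec_R W` of Weil algebras. -/
def IsSmall (S : C) : Prop :=
  ∃ (W : Type w) (_ : CommRing W) (_ : Algebra k W),
    IsWeilAlgebra k W ∧ ∃ g : W →ₐ[k] (S ⟶ R), IsSpec k R W S g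

/-- The general Kock-Lawvere axiom: for every Weil algebra `W`, the canonical map from `R ⊗ W` to
`R ^ (Spec_R W)` is an isomorphism, that is, bijective on elements at every stage `T`. -/
class KockLawvere : Prop where
  bijective : ∀ (W : Type w) [CommRing W] [Algebra k W], IsWeilAlgebra k W →
    ∀ (S : C) (g : W →ₐ[k] (S ⟶ R)), IsSpec k R W S g → ∀ T : C,
      Function.Bijective
        (Algebra.TensorProduct.productMap (pull k (R := R) (fst T S)) ((pull k (snd T S)).comp g))

end Objects

section Micro
variable {C : Type u} [Category.{v} C] [CartesianMonoidalCategory C]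

/-- `X` perceives the cocone `c` as a colimit: the exponential `X ^ (-)` turns `c` into a limit
cone. It is spelled out on elements at each stage `T`. -/
def Perceives (X : C) {J : Type} [SmallCategory J] {F : J ⥤ C} (c : Cocone F) : Prop :=
  ∀ (T : C) (g : ∀ j, T ⊗ F.obj j ⟶ X),
    (∀ (i j : J) (φ : i ⟶ j), T ◁ F.map φ ≫ g j = g i) →
      ∃! h : T ⊗ c.pt ⟶ X, ∀ j, T ◁ c.ι.app j ≫ h = g j

/-- `M` is microlinear: it perceives as a colimit every quasi-colimit of small objects, that is,
every finite cocone of small objects that the line `R` perceives as a colimit. -/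
class Microlinear [BraidedCategory C] (k : Type w) [CommRing k] (R : C) [CommRingObj R]
    [AlgebraObj k R] (M : C) : Prop where
  perceives : ∀ (J : Type) [SmallCategory J] [FinCategory J] (F : J ⥤ C) (c : Cocone F),
    (∀ j, IsSmall k R (F.obj j)) → IsSmall k R c.pt → Perceives R c → Perceives M c

end Micro

section Simplicial
variable {C : Type u} [Category.{v} C] [CartesianMonoidalCategory C] [BraidedCategory C]
  [HasFiniteLimits C]

/-- The pairs `(i, j)` for which `dᵢ dⱼ = 0` is required in `Dⁿ{p}`: the diagonal and `p`. -/
abbrev killed {n : ℕ} (p : Finset (Fin n × Fin n)) (q : Fin n × Fin n) : Prop :=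
  q.1 = q.2 ∨ q ∈ p

/-- `(d₁, …, dₙ) ↦ (dᵢ dⱼ)` for the pairs `(i, j)` above. -/
def relMap (R : C) [CommRingObj R] (n : ℕ) (p : Finset (Fin n × Fin n)) :
    (∏ᶜ fun _ : Fin n => R) ⟶ (∏ᶜ fun _ : {q // killed p q} => R) :=
  Pi.lift fun q => Pi.π (fun _ : Fin n => R) q.1.1 * Pi.π (fun _ : Fin n => R) q.1.2

/-- The simplicial small object
`Dⁿ{p} = {(d₁, …, dₙ) ∈ Rⁿ | dᵢ² = 0 for all i, dᵢ dⱼ = 0 for all (i, j) ∈ p}`,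
with indices counted from `0`. In particular `D = Dpow R 1 ∅`, `D² = Dpow R 2 ∅` and
`D(2) = Dpow R 2 {(0, 1)}`. -/
def Dpow (R : C) [CommRingObj R] (n : ℕ) (p : Finset (Fin n × Fin n)) : C :=
  equalizer (relMap R n p) (Pi.lift fun _ => 0)

namespace Dpow
variable {R : C} [CommRingObj R] {n : ℕ} {p : Finset (Fin n × Fin n)}

/-- The `i`-th coordinate `Dⁿ{p} → R`. -/
def coord (i : Fin n) : Dpow R n p ⟶ R := equalizer.ι _ _ ≫ Pi.π (fun _ : Fin n => R) i

theorem coord_mul (i j : Fin n) (h : killed p (i, j)) :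
    coord (R := R) (p := p) i * coord j = 0 := by
  have := equalizer.condition (relMap R n p) (Pi.lift fun _ => 0) =≫ Pi.π _ ⟨(i, j), h⟩
  simp only [relMap, Category.assoc, Pi.lift_π, MonObj.comp_mul, AddMonObj.comp_zero] at this
  exact this

theorem coord_self (i : Fin n) : coord (R := R) (p := p) i * coord i = 0 :=
  coord_mul i i (Or.inl rfl)

/-- The element of `Dⁿ{p}` with given coordinates, at stage `A`. -/
def mk {A : C} (d : Fin n → (A ⟶ R)) (hd : ∀ i j, killed p (i, j) → d i * d j = 0) :
    A ⟶ Dpow R n p :=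
  equalizer.lift (Pi.lift d) (by
    apply Pi.hom_ext
    intro q
    simp [relMap, MonObj.comp_mul, AddMonObj.comp_zero, hd _ _ q.2])

@[simp] theorem mk_coord {A : C} (d : Fin n → (A ⟶ R)) (hd) (i : Fin n) :
    mk (p := p) d hd ≫ coord i = d i := by
  exact (equalizer.lift_ι_assoc (Pi.lift d) _ _).trans (Pi.lift_π d i)

theorem hom_ext {A : C} {f g : A ⟶ Dpow R n p} (h : ∀ i, f ≫ coord i = g ≫ coord i) : f = g := by
  apply equalizer.hom_ext
  apply Pi.hom_ext
  intro i
  exact (Category.assoc _ _ _).trans ((h i).trans (Category.assoc _ _ _).symm)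

/-- The origin, at every stage `A`. -/
def zero {A : C} : A ⟶ Dpow R n p := mk (fun _ => 0) (by simp)

@[simp] theorem comp_zero {A B : C} (f : B ⟶ A) : f ≫ (zero : A ⟶ Dpow R n p) = zero :=
  hom_ext fun i => by simp [zero, AddMonObj.comp_zero]

end Dpow
end Simplicial

section Monomial
variable (k : Type w) [CommRing k] {n : ℕ} (p : Finset (Fin n × Fin n))

/-- The ideal of relations of `Dⁿ{p}`. -/
def relIdeal : Ideal (MvPolynomial (Fin n) k) :=
  Ideal.span ((fun s => MvPolynomial.monomial s (1 : k)) ''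
    {s | ∃ i j, killed p (i, j) ∧ s = Finsupp.single i 1 + Finsupp.single j 1})

/-- The Weil algebra of `Dⁿ{p}`. -/
abbrev WeilOf : Type w := MvPolynomial (Fin n) k ⧸ relIdeal k p

/-- The sets `S` whose monomial `∏ i ∈ S, Xᵢ` is not killed. -/
abbrev Indep (S : Finset (Fin n)) : Prop := ∀ i ∈ S, ∀ j ∈ S, i ≠ j → (i, j) ∉ p

/-- The exponent of the monomial `∏ i ∈ S, Xᵢ`. -/
def ind (S : Finset (Fin n)) : Fin n →₀ ℕ := Finsupp.indicator S (fun _ _ => 1)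

theorem ind_apply (S : Finset (Fin n)) (i : Fin n) : ind S i = if i ∈ S then 1 else 0 := by
  simp [ind, Finsupp.indicator_apply]

theorem ind_injective : Function.Injective (ind (n := n)) := by
  intro S S' h
  ext i
  have := DFunLike.congr_fun h i
  simp only [ind_apply] at this
  by_cases h1 : i ∈ S <;> by_cases h2 : i ∈ S' <;> simp_all

theorem not_le_ind {S : Finset (Fin n)} (hS : Indep p S) :
    ¬ ∃ s ∈ {s : Fin n →₀ ℕ | ∃ i j, killed p (i, j) ∧ s = Finsupp.single i 1 + Finsupp.single j 1},
      s ≤ ind S := by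
  rintro ⟨_, ⟨i, j, h, rfl⟩, hle⟩
  have hi := hle i
  have hj := hle j
  simp only [ind_apply, Finsupp.add_apply, Finsupp.single_apply] at hi hj
  by_cases hij : i = j
  · subst hij
    split_ifs at hi <;> simp_all
  · have hji : j ≠ i := fun h => hij h.symm
    have h1 : i ∈ S := by by_contra hc; simp [hc] at hi
    have h2 : j ∈ S := by by_contra hc; simp [hc] at hj
    exact hS i h1 j h2 hij (h.resolve_left hij)

theorem exists_ind (s : Fin n →₀ ℕ)
    (hs : ¬ ∃ t ∈ {s : Fin n →₀ ℕ | ∃ i j, killed p (i, j) ∧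
      s = Finsupp.single i 1 + Finsupp.single j 1}, t ≤ s) :
    ∃ S, Indep p S ∧ s = ind S := by
  refine ⟨s.support, ?_, ?_⟩
  · intro i hi j hj hij hp
    refine hs ⟨_, ⟨i, j, Or.inr hp, rfl⟩, fun a => ?_⟩
    simp only [Finsupp.mem_support_iff] at hi hj
    simp only [Finsupp.add_apply, Finsupp.single_apply]
    split_ifs <;> grind
  · ext i
    rw [ind_apply]
    have h2 : s i < 2 := by
      by_contra hc
      refine hs ⟨_, ⟨i, i, Or.inl rfl, rfl⟩, fun a => ?_⟩
      simp only [Finsupp.add_apply, Finsupp.single_apply]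
      split_ifs <;> grind
    by_cases h : s i = 0
    · simp [h]
    · simp [h]; omega

/-- The class of the monomial `∏ i ∈ S, Xᵢ`. -/
def mono (S : Finset (Fin n)) : WeilOf k p :=
  Ideal.Quotient.mk _ (MvPolynomial.monomial (ind S) 1)

theorem linearIndependent_mono :
    LinearIndependent k (fun S : {S // Indep p S} => mono k p S.1) := by
  rw [Fintype.linearIndependent_iff]
  intro c hc S
  have h1 : (Ideal.Quotient.mk (relIdeal k p))
      (∑ S : {S // Indep p S}, MvPolynomial.monomial (ind S.1) (c S)) = 0 := by
    rw [map_sum, ← hc]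
    refine Finset.sum_congr rfl fun S _ => ?_
    have : MvPolynomial.monomial (ind S.1) (c S) = c S • MvPolynomial.monomial (ind S.1) (1 : k) := by
      simp [MvPolynomial.smul_monomial]
    rw [this]; rfl
  rw [Ideal.Quotient.eq_zero_iff_mem, relIdeal, MvPolynomial.mem_ideal_span_monomial_image] at h1
  by_contra hne
  refine not_le_ind p S.2 (h1 (ind S.1) ?_)
  rw [MvPolynomial.mem_support_iff, MvPolynomial.coeff_sum, Finset.sum_eq_single S]
  · simpa using hne
  · intro S' _ hS'
    rw [MvPolynomial.coeff_monomial, if_neg]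
    exact fun h => hS' (Subtype.ext (ind_injective h))
  · simp

theorem span_mono : ⊤ ≤ Submodule.span k (Set.range fun S : {S // Indep p S} => mono k p S.1) := by
  rintro x -
  obtain ⟨P, rfl⟩ := Ideal.Quotient.mk_surjective x
  induction P using MvPolynomial.induction_on' with
  | add p q hp hq => rw [map_add]; exact Submodule.add_mem _ hp hq
  | monomial s a =>
    have : MvPolynomial.monomial s a = a • MvPolynomial.monomial s (1 : k) := by
      simp [MvPolynomial.smul_monomial]
    rw [this]
    refine Submodule.smul_mem _ a (?_ : Ideal.Quotient.mk (relIdeal k p) (MvPolynomial.monomial s 1) ∈ _)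
    by_cases hs : ∃ t ∈ {s : Fin n →₀ ℕ | ∃ i j, killed p (i, j) ∧
      s = Finsupp.single i 1 + Finsupp.single j 1}, t ≤ s
    · have : Ideal.Quotient.mk (relIdeal k p) (MvPolynomial.monomial s 1) = 0 := by
        rw [Ideal.Quotient.eq_zero_iff_mem, relIdeal, MvPolynomial.mem_ideal_span_monomial_image]
        intro t ht
        have := MvPolynomial.support_monomial_subset ht
        rw [Finset.mem_singleton] at this
        rwa [this]
      rw [this]; exact Submodule.zero_mem _
    · obtain ⟨S, hS, rfl⟩ := exists_ind p s hs
      exact Submodule.subset_span ⟨⟨S, hS⟩, rfl⟩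

/-- The surviving monomials form a basis. -/
def monoBasis : Module.Basis {S // Indep p S} k (WeilOf k p) :=
  Module.Basis.mk (linearIndependent_mono k p) (span_mono k p)

theorem X_mul_X (i j : Fin n) (h : killed p (i, j)) :
    (Ideal.Quotient.mk (relIdeal k p) (MvPolynomial.X i)) *
      (Ideal.Quotient.mk (relIdeal k p) (MvPolynomial.X j)) = 0 := by
  rw [← map_mul, Ideal.Quotient.eq_zero_iff_mem]
  refine Ideal.subset_span ⟨_, ⟨i, j, h, rfl⟩, ?_⟩
  simp [MvPolynomial.X, MvPolynomial.monomial_mul]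

variable {k p} in
/-- The homomorphism given by a tuple that satisfies the relations. -/
def weilLift {B : Type*} [CommRing B] [Algebra k B] (d : Fin n → B)
    (hd : ∀ i j, killed p (i, j) → d i * d j = 0) : WeilOf k p →ₐ[k] B :=
  Ideal.Quotient.liftₐ _ (MvPolynomial.aeval d) (by
    intro a ha
    have : relIdeal k p ≤ RingHom.ker (MvPolynomial.aeval d : _ →ₐ[k] B) := by
      refine Ideal.span_le.2 ?_
      rintro _ ⟨_, ⟨i, j, h, rfl⟩, rfl⟩
      have : MvPolynomial.monomial (Finsupp.single i 1 + Finsupp.single j 1) (1 : k)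
        = MvPolynomial.X i * MvPolynomial.X j := by
          simp [MvPolynomial.X, MvPolynomial.monomial_mul]
      simp [this, RingHom.mem_ker, hd i j h]
    exact this ha)

theorem weilLift_X {B : Type*} [CommRing B] [Algebra k B] (d : Fin n → B) (hd) (i : Fin n) :
    weilLift (k := k) (p := p) d hd (Ideal.Quotient.mk _ (MvPolynomial.X i)) = d i :=
  (Ideal.Quotient.lift_mk _ _ _).trans (MvPolynomial.aeval_X d i)

theorem weilLift_mono {B : Type*} [CommRing B] [Algebra k B] (d : Fin n → B) (hd) (S) :
    weilLift (k := k) (p := p) d hd (mono k p S) = ∏ i ∈ S, d i := by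
  refine (Ideal.Quotient.lift_mk _ _ _).trans ?_
  change MvPolynomial.aeval d (MvPolynomial.monomial (ind S) (1 : k)) = _
  simp [MvPolynomial.aeval_monomial, Finsupp.prod_fintype, ind_apply, Finset.prod_ite_mem,
    pow_ite]

theorem isWeilAlgebra_weilOf : IsWeilAlgebra k (WeilOf k p) where
  free := Module.Free.of_basis (monoBasis k p)
  finite := Module.Finite.of_basis (monoBasis k p)
  exists_augmentation := by
    refine ⟨weilLift (fun _ => 0) (by simp), ?_⟩
    set ε : WeilOf k p →ₐ[k] k := weilLift (fun _ => 0) (by simp)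
    have hker : RingHom.ker ε = Ideal.span (Set.range fun i : Fin n =>
        Ideal.Quotient.mk (relIdeal k p) (MvPolynomial.X i)) := by
      apply le_antisymm
      · intro x hx
        obtain ⟨P, rfl⟩ := Ideal.Quotient.mk_surjective x
        have h0 : MvPolynomial.constantCoeff P = 0 := by
          have h1 : MvPolynomial.aeval (fun _ : Fin n => (0 : k)) P = 0 :=
            (Ideal.Quotient.lift_mk _ _ _).symm.trans hx
          simpa [MvPolynomial.aeval_zero'] using h1
        have hP : P ∈ Ideal.span (MvPolynomial.X '' (Set.univ : Set (Fin n)) :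
            Set (MvPolynomial (Fin n) k)) := by
          rw [MvPolynomial.mem_ideal_span_X_image]
          intro m hm
          by_contra hc
          push Not at hc
          have : m = 0 := by ext i; simpa using hc i
          subst this
          exact (MvPolynomial.mem_support_iff.1 hm) h0
        have := Ideal.mem_map_of_mem (Ideal.Quotient.mk (relIdeal k p)) hP
        rw [Ideal.map_span, Set.image_univ, ← Set.range_comp] at this
        exact this
      · refine Ideal.span_le.2 ?_
        rintro _ ⟨i, rfl⟩
        simp only [SetLike.mem_coe, RingHom.mem_ker]
        exact weilLift_X k p _ _ i
    rw [hker, Ideal.FG.isNilpotent_iff_le_nilradical (Submodule.fg_span (Set.finite_range _))]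
    refine Ideal.span_le.2 ?_
    rintro _ ⟨i, rfl⟩
    exact ⟨2, by rw [pow_two]; exact X_mul_X k p i i (Or.inl rfl)⟩

end Monomial

section Expansion
variable {C : Type u} [Category.{v} C] [CartesianMonoidalCategory C] [BraidedCategory C]
  [HasFiniteLimits C]
variable (k : Type w) [CommRing k] {R : C} [CommRingObj R] [AlgebraObj k R]
  {n : ℕ} (p : Finset (Fin n × Fin n))

theorem isSpec_Dpow : IsSpec k R (WeilOf k p) (Dpow R n p)
    (weilLift (fun i => Dpow.coord i) (fun i j h => Dpow.coord_mul i j h)) := by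
  intro A φ
  refine ⟨Dpow.mk (fun i => φ (Ideal.Quotient.mk _ (MvPolynomial.X i))) ?_, ?_, ?_⟩
  · intro i j h
    rw [← map_mul, X_mul_X k p i j h, map_zero]
  · apply Ideal.Quotient.algHom_ext
    apply MvPolynomial.algHom_ext
    intro i
    change _ ≫ weilLift (fun i => Dpow.coord i) (fun i j h => Dpow.coord_mul i j h)
      (Ideal.Quotient.mk _ (MvPolynomial.X i)) = _
    rw [weilLift_X, Dpow.mk_coord]
    rfl
  · intro f hf
    apply Dpow.hom_ext
    intro i
    rw [Dpow.mk_coord, ← hf]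
    change _ = f ≫ weilLift (fun i => Dpow.coord i) (fun i j h => Dpow.coord_mul i j h)
      (Ideal.Quotient.mk _ (MvPolynomial.X i))
    rw [weilLift_X]

theorem isSmall_Dpow : IsSmall k R (Dpow R n p) :=
  ⟨WeilOf k p, inferInstance, inferInstance, isWeilAlgebra_weilOf k p, _, isSpec_Dpow k p⟩

variable (T : C)

/-- The polynomial function on `Dⁿ{p}` with coefficients `c`. -/
def polyFun (c : {S // Indep p S} → (T ⟶ R)) : T ⊗ Dpow R n p ⟶ R :=
  ∑ S, (fst T (Dpow R n p) ≫ c S) * ∏ i ∈ S.1, snd T (Dpow R n p) ≫ Dpow.coord i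

theorem polyFun_bijective [KockLawvere k R] :
    Function.Bijective (polyFun (R := R) p T) := by
  have h := KockLawvere.bijective (WeilOf k p) (isWeilAlgebra_weilOf k p) (Dpow R n p) _
    (isSpec_Dpow (R := R) k p) T
  let b := Algebra.TensorProduct.basis (T ⟶ R) (monoBasis k p)
  convert h.comp b.equivFun.symm.bijective using 1
  funext c
  simp only [Function.comp_apply, Module.Basis.equivFun_symm_apply, map_sum, polyFun]
  refine Finset.sum_congr rfl fun S _ => ?_
  rw [Algebra.TensorProduct.basis_apply, TensorProduct.smul_tmul', smul_eq_mul, mul_one,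
    Algebra.TensorProduct.productMap_apply_tmul]
  congr 1
  rw [monoBasis, Module.Basis.mk_apply]
  change _ = pull k _ (weilLift (fun i => Dpow.coord i) (fun i j h => Dpow.coord_mul i j h)
    (mono k p S.1))
  rw [weilLift_mono, map_prod]
  rfl

end Expansion

section Glue
variable {C : Type u} [Category.{v} C] [CartesianMonoidalCategory C] [BraidedCategory C]
variable (k : Type w) [CommRing k] (R : C) [CommRingObj R] [AlgebraObj k R]

/-- Microlinearity for a square of small objects. -/
theorem exists_unique_glue {M : C} [Microlinear k R M] {X Y Z P : C} (f : X ⟶ Y) (g : X ⟶ Z)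
    (i : Y ⟶ P) (j : Z ⟶ P) (comm : f ≫ i = g ≫ j) (hX : IsSmall k R X) (hY : IsSmall k R Y)
    (hZ : IsSmall k R Z) (hP : IsSmall k R P)
    (hR : ∀ (T : C) (a : T ⊗ Y ⟶ R) (b : T ⊗ Z ⟶ R), T ◁ f ≫ a = T ◁ g ≫ b →
      ∃! h : T ⊗ P ⟶ R, T ◁ i ≫ h = a ∧ T ◁ j ≫ h = b)
    (T : C) (a : T ⊗ Y ⟶ M) (b : T ⊗ Z ⟶ M) (hab : T ◁ f ≫ a = T ◁ g ≫ b) :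
    ∃! h : T ⊗ P ⟶ M, T ◁ i ≫ h = a ∧ T ◁ j ≫ h = b := by
  have key := Microlinear.perceives (k := k) (R := R) (M := M) WalkingSpan (span f g)
    (PushoutCocone.mk i j comm) (by rintro (_ | _ | _) <;> assumption) hP (by
      intro T γ hγ
      obtain ⟨h, ⟨h1, h2⟩, h3⟩ := hR T (γ WalkingSpan.left) (γ WalkingSpan.right)
        ((hγ _ _ WalkingSpan.Hom.fst).trans (hγ _ _ WalkingSpan.Hom.snd).symm)
      refine ⟨h, ?_, fun h' hh' => h3 h' ⟨hh' WalkingSpan.left, hh' WalkingSpan.right⟩⟩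
      rintro (_ | _ | _)
      · refine Eq.trans ?_ (hγ _ _ WalkingSpan.Hom.fst)
        rw [← h1]
        change T ◁ (f ≫ i) ≫ h = T ◁ f ≫ T ◁ i ≫ h
        rw [MonoidalCategory.whiskerLeft_comp, Category.assoc]
      · exact h1
      · exact h2)
  obtain ⟨h, h1, h2⟩ := key T
    (fun | .zero => T ◁ f ≫ a | .left => a | .right => b) (by
      rintro _ _ (_ | (_ | _))
      · exact (congrArg (· ≫ _) ((congrArg (T ◁ ·) ((span f g).map_id _)).trans
          (MonoidalCategory.whiskerLeft_id _ _))).trans (Category.id_comp _)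
      · rfl
      · exact hab.symm)
  refine ⟨h, ⟨h1 WalkingSpan.left, h1 WalkingSpan.right⟩, fun h' hh' => h2 h' ?_⟩
  rintro (_ | _ | _)
  · change T ◁ (f ≫ i) ≫ h' = T ◁ f ≫ a
    rw [MonoidalCategory.whiskerLeft_comp, Category.assoc, hh'.1]
  · exact hh'.1
  · exact hh'.2

end Glue

section Concrete
variable {C : Type u} [Category.{v} C] [CartesianMonoidalCategory C] [BraidedCategory C]
  [HasFiniteLimits C]

section Exp
variable {R : C} [CommRingObj R]
  {n : ℕ} (p : Finset (Fin n × Fin n)) {T : C}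

theorem sum_eq_polyFun (L : Finset (Finset (Fin n))) (hL : Finset.univ.filter (Indep p) = L)
    (c : Finset (Fin n) → (T ⟶ R)) :
    ∑ S ∈ L, (fst T (Dpow R n p) ≫ c S) * ∏ i ∈ S, snd T (Dpow R n p) ≫ Dpow.coord i =
      polyFun p T (fun S => c S.1) := by
  rw [polyFun]
  exact Finset.sum_subtype L (fun S => by simp [← hL])
    (fun S => (fst T (Dpow R n p) ≫ c S) * ∏ i ∈ S, snd T (Dpow R n p) ≫ Dpow.coord i)

theorem expand_exists (k : Type w) [CommRing k] [AlgebraObj k R] [KockLawvere k R]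
    (L : Finset (Finset (Fin n))) (hL : Finset.univ.filter (Indep p) = L)
    (f : T ⊗ Dpow R n p ⟶ R) : ∃ c : Finset (Fin n) → (T ⟶ R),
      f = ∑ S ∈ L, (fst T (Dpow R n p) ≫ c S) * ∏ i ∈ S, snd T (Dpow R n p) ≫ Dpow.coord i := by
  obtain ⟨c, rfl⟩ := (polyFun_bijective k p T).2 f
  refine ⟨fun S => if h : Indep p S then c ⟨S, h⟩ else 0, ?_⟩
  rw [sum_eq_polyFun p L hL]
  congr 1
  funext S
  rw [dif_pos S.2]

theorem expand_unique (k : Type w) [CommRing k] [AlgebraObj k R] [KockLawvere k R]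
    (L : Finset (Finset (Fin n))) (hL : Finset.univ.filter (Indep p) = L)
    (c c' : Finset (Fin n) → (T ⟶ R))
    (h : ∑ S ∈ L, (fst T (Dpow R n p) ≫ c S) * ∏ i ∈ S, snd T (Dpow R n p) ≫ Dpow.coord i =
      ∑ S ∈ L, (fst T (Dpow R n p) ≫ c' S) * ∏ i ∈ S, snd T (Dpow R n p) ≫ Dpow.coord i) :
    ∀ S ∈ L, c S = c' S := by
  rw [sum_eq_polyFun p L hL, sum_eq_polyFun p L hL] at h
  intro S hS
  rw [← hL, Finset.mem_filter] at hS
  exact congrFun ((polyFun_bijective k p T).1 h) ⟨S, hS.2⟩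

end Exp

section Coeffs
variable {R : C} [CommRingObj R]
  {T : C}

theorem exp_D (k : Type w) [CommRing k] [AlgebraObj k R] [KockLawvere k R]
    (f : T ⊗ Dpow R 1 ∅ ⟶ R) : ∃ a b : T ⟶ R,
    f = fst _ _ ≫ a + (fst _ _ ≫ b) * (snd _ _ ≫ Dpow.coord 0) := by
  obtain ⟨c, hc⟩ := expand_exists (n := 1) ∅ k {∅, {0}} (by decide) f
  exact ⟨c ∅, c {0}, by rw [hc, Finset.sum_pair (by decide)]; simp⟩

theorem exp_D_unique (k : Type w) [CommRing k] [AlgebraObj k R] [KockLawvere k R]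
    {a b a' b' : T ⟶ R}
    (h : fst T (Dpow R 1 ∅) ≫ a + (fst _ _ ≫ b) * (snd _ _ ≫ Dpow.coord 0) =
      fst T (Dpow R 1 ∅) ≫ a' + (fst _ _ ≫ b') * (snd _ _ ≫ Dpow.coord 0)) : a = a' ∧ b = b' := by
  have := expand_unique (n := 1) ∅ k {∅, {0}} (by decide) (fun S => if S = ∅ then a else b)
    (fun S => if S = ∅ then a' else b') (by
      rw [Finset.sum_pair (by decide), Finset.sum_pair (by decide)]; simpa using h)
  exact ⟨by simpa using this ∅ (by decide), by simpa using this {0} (by decide)⟩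

theorem exp_D2 (k : Type w) [CommRing k] [AlgebraObj k R] [KockLawvere k R]
    (f : T ⊗ Dpow R 2 {(0, 1)} ⟶ R) : ∃ a b c : T ⟶ R,
    f = fst _ _ ≫ a + (fst _ _ ≫ b) * (snd _ _ ≫ Dpow.coord 0)
      + (fst _ _ ≫ c) * (snd _ _ ≫ Dpow.coord 1) := by
  obtain ⟨c, hc⟩ := expand_exists (n := 2) {(0, 1)} k {∅, {0}, {1}} (by decide) f
  refine ⟨c ∅, c {0}, c {1}, ?_⟩
  rw [hc, Finset.sum_insert (by decide), Finset.sum_pair (by decide)]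
  simp [add_assoc]

theorem exp_D2_unique (k : Type w) [CommRing k] [AlgebraObj k R] [KockLawvere k R]
    {a b c a' b' c' : T ⟶ R}
    (h : fst T (Dpow R 2 {(0, 1)}) ≫ a + (fst _ _ ≫ b) * (snd _ _ ≫ Dpow.coord 0)
        + (fst _ _ ≫ c) * (snd _ _ ≫ Dpow.coord 1) =
      fst T (Dpow R 2 {(0, 1)}) ≫ a' + (fst _ _ ≫ b') * (snd _ _ ≫ Dpow.coord 0)
        + (fst _ _ ≫ c') * (snd _ _ ≫ Dpow.coord 1)) : a = a' ∧ b = b' ∧ c = c' := by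
  have := expand_unique (n := 2) {(0, 1)} k {∅, {0}, {1}} (by decide)
    (fun S => if S = ∅ then a else if S = {0} then b else c)
    (fun S => if S = ∅ then a' else if S = {0} then b' else c') (by
      rw [Finset.sum_insert (by decide), Finset.sum_pair (by decide),
        Finset.sum_insert (by decide), Finset.sum_pair (by decide)]
      simpa [add_assoc] using h)
  exact ⟨by simpa using this ∅ (by decide), by simpa using this {0} (by decide),
    by simpa using this {1} (by decide)⟩

theorem exp_DD (k : Type w) [CommRing k] [AlgebraObj k R] [KockLawvere k R]
    (f : T ⊗ Dpow R 2 ∅ ⟶ R) : ∃ a b c e : T ⟶ R,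
    f = fst _ _ ≫ a + (fst _ _ ≫ b) * (snd _ _ ≫ Dpow.coord 0)
      + (fst _ _ ≫ c) * (snd _ _ ≫ Dpow.coord 1)
      + (fst _ _ ≫ e) * ((snd _ _ ≫ Dpow.coord 0) * (snd _ _ ≫ Dpow.coord 1)) := by
  obtain ⟨c, hc⟩ := expand_exists (n := 2) ∅ k {∅, {0}, {1}, {0, 1}} (by decide) f
  refine ⟨c ∅, c {0}, c {1}, c {0, 1}, ?_⟩
  rw [hc, Finset.sum_insert (by decide), Finset.sum_insert (by decide),
    Finset.sum_pair (by decide)]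
  simp [add_assoc]

theorem exp_DD_unique (k : Type w) [CommRing k] [AlgebraObj k R] [KockLawvere k R]
    {a b c e a' b' c' e' : T ⟶ R}
    (h : fst T (Dpow R 2 ∅) ≫ a + (fst _ _ ≫ b) * (snd _ _ ≫ Dpow.coord 0)
        + (fst _ _ ≫ c) * (snd _ _ ≫ Dpow.coord 1)
        + (fst _ _ ≫ e) * ((snd _ _ ≫ Dpow.coord 0) * (snd _ _ ≫ Dpow.coord 1)) =
      fst T (Dpow R 2 ∅) ≫ a' + (fst _ _ ≫ b') * (snd _ _ ≫ Dpow.coord 0)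
        + (fst _ _ ≫ c') * (snd _ _ ≫ Dpow.coord 1)
        + (fst _ _ ≫ e') * ((snd _ _ ≫ Dpow.coord 0) * (snd _ _ ≫ Dpow.coord 1))) :
    a = a' ∧ b = b' ∧ c = c' ∧ e = e' := by
  have := expand_unique (n := 2) ∅ k {∅, {0}, {1}, {0, 1}} (by decide)
    (fun S => if S = ∅ then a else if S = {0} then b else if S = {1} then c else e)
    (fun S => if S = ∅ then a' else if S = {0} then b' else if S = {1} then c' else e') (by
      rw [Finset.sum_insert (by decide), Finset.sum_insert (by decide),
        Finset.sum_pair (by decide), Finset.sum_insert (by decide),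
        Finset.sum_insert (by decide), Finset.sum_pair (by decide)]
      have e1 : ({0, 1} : Finset (Fin 2)) ≠ ∅ := by decide
      have e2 : ({0, 1} : Finset (Fin 2)) ≠ {0} := by decide
      have e3 : ({0, 1} : Finset (Fin 2)) ≠ {1} := by decide
      simpa [add_assoc, e1, e2, e3] using h)
  have e1 : ({0, 1} : Finset (Fin 2)) ≠ ∅ := by decide
  have e2 : ({0, 1} : Finset (Fin 2)) ≠ {0} := by decide
  have e3 : ({0, 1} : Finset (Fin 2)) ≠ {1} := by decide
  exact ⟨by simpa using this ∅ (by decide), by simpa using this {0} (by decide),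
    by simpa using this {1} (by decide), by simpa [e1, e2, e3] using this {0, 1} (by decide)⟩

theorem exp_E (k : Type w) [CommRing k] [AlgebraObj k R] [KockLawvere k R]
    (f : T ⊗ Dpow R 3 {(0, 2), (1, 2)} ⟶ R) : ∃ a b c e h : T ⟶ R,
    f = fst _ _ ≫ a + (fst _ _ ≫ b) * (snd _ _ ≫ Dpow.coord 0)
      + (fst _ _ ≫ c) * (snd _ _ ≫ Dpow.coord 1)
      + (fst _ _ ≫ e) * ((snd _ _ ≫ Dpow.coord 0) * (snd _ _ ≫ Dpow.coord 1))
      + (fst _ _ ≫ h) * (snd _ _ ≫ Dpow.coord 2) := by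
  obtain ⟨c, hc⟩ := expand_exists (n := 3) {(0, 2), (1, 2)} k {∅, {0}, {1}, {0, 1}, {2}} (by decide) f
  refine ⟨c ∅, c {0}, c {1}, c {0, 1}, c {2}, ?_⟩
  rw [hc, Finset.sum_insert (by decide), Finset.sum_insert (by decide),
    Finset.sum_insert (by decide), Finset.sum_pair (by decide)]
  simp [add_assoc]

end Coeffs

section Maps
variable {R : C} [CommRingObj R]

/-- `(d₁, d₂) ∈ D(2) ↦ (d₁, d₂) ∈ D²`. -/
def inclD2 : Dpow R 2 {(0, 1)} ⟶ Dpow R 2 ∅ :=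
  Dpow.mk ![Dpow.coord 0, Dpow.coord 1] (by
    intro i j h
    fin_cases i <;> fin_cases j <;> simp [killed] at h ⊢ <;> exact Dpow.coord_mul _ _ (by decide))

/-- `d ∈ D ↦ (d, 0) ∈ D(2)`. -/
def axis₁ : Dpow R 1 ∅ ⟶ Dpow R 2 {(0, 1)} :=
  Dpow.mk ![Dpow.coord 0, 0] (by
    intro i j h
    fin_cases i <;> fin_cases j <;> simp [Dpow.coord_self])

/-- `d ∈ D ↦ (0, d) ∈ D(2)`. -/
def axis₂ : Dpow R 1 ∅ ⟶ Dpow R 2 {(0, 1)} :=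
  Dpow.mk ![0, Dpow.coord 0] (by
    intro i j h
    fin_cases i <;> fin_cases j <;> simp [Dpow.coord_self])

/-- `d ∈ D ↦ (d, d) ∈ D(2)`. -/
def diag : Dpow R 1 ∅ ⟶ Dpow R 2 {(0, 1)} :=
  Dpow.mk ![Dpow.coord 0, Dpow.coord 0] (by
    intro i j h
    fin_cases i <;> fin_cases j <;> simp [Dpow.coord_self])

/-- `(d₁, d₂) ∈ D² ↦ (d₁, d₂, d₁ d₂) ∈ D³{(1,3),(2,3)}`. -/
def j₁ : Dpow R 2 ∅ ⟶ Dpow R 3 {(0, 2), (1, 2)} :=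
  Dpow.mk ![Dpow.coord 0, Dpow.coord 1, Dpow.coord 0 * Dpow.coord 1] (by
    have h0 : Dpow.coord (R := R) (p := ∅) (0 : Fin 2) * Dpow.coord 0 = 0 :=
      Dpow.coord_mul _ _ (by decide)
    have h1 : Dpow.coord (R := R) (p := ∅) (1 : Fin 2) * Dpow.coord 1 = 0 :=
      Dpow.coord_mul _ _ (by decide)
    intro i j h
    fin_cases i <;> fin_cases j <;> simp [killed] at h ⊢ <;> grind)

/-- `(d₁, d₂) ∈ D² ↦ (d₁, d₂, 0) ∈ D³{(1,3),(2,3)}`. -/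
def j₂ : Dpow R 2 ∅ ⟶ Dpow R 3 {(0, 2), (1, 2)} :=
  Dpow.mk ![Dpow.coord 0, Dpow.coord 1, 0] (by
    intro i j h
    fin_cases i <;> fin_cases j <;> simp [killed] at h ⊢ <;> exact Dpow.coord_mul _ _ (by decide))

/-- `d ∈ D ↦ (0, 0, d) ∈ D³{(1,3),(2,3)}`. -/
def axis₃ : Dpow R 1 ∅ ⟶ Dpow R 3 {(0, 2), (1, 2)} :=
  Dpow.mk ![0, 0, Dpow.coord 0] (by
    intro i j h
    fin_cases i <;> fin_cases j <;> simp [Dpow.coord_self])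

end Maps

section Perc
variable {R : C} [CommRingObj R]

theorem perceives_D2 (k : Type w) [CommRing k] [AlgebraObj k R] [KockLawvere k R]
    (T : C) (a b : T ⊗ Dpow R 1 ∅ ⟶ R)
    (hab : T ◁ (Dpow.zero : Dpow R 0 ∅ ⟶ Dpow R 1 ∅) ≫ a = T ◁ Dpow.zero ≫ b) :
    ∃! h : T ⊗ Dpow R 2 {(0, 1)} ⟶ R, T ◁ axis₁ ≫ h = a ∧ T ◁ axis₂ ≫ h = b := by
  obtain ⟨a0, a1, rfl⟩ := exp_D k a
  obtain ⟨b0, b1, rfl⟩ := exp_D k b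
  have h0 : a0 = b0 := by
    have := lift (𝟙 T) Dpow.zero ≫= hab
    simpa [Dpow.zero, AddMonObj.comp_add, MonObj.comp_mul, AddMonObj.comp_zero] using this
  subst h0
  refine ⟨fst _ _ ≫ a0 + (fst _ _ ≫ a1) * (snd _ _ ≫ Dpow.coord 0)
      + (fst _ _ ≫ b1) * (snd _ _ ≫ Dpow.coord 1), ?_, ?_⟩
  · simp [axis₁, axis₂, AddMonObj.comp_add, MonObj.comp_mul, AddMonObj.comp_zero]
  · rintro h ⟨h1, h2⟩
    obtain ⟨e0, e1, e2, rfl⟩ := exp_D2 k h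
    simp [axis₁, axis₂, AddMonObj.comp_add, MonObj.comp_mul, AddMonObj.comp_zero] at h1 h2
    obtain ⟨rfl, rfl⟩ := exp_D_unique k h1
    obtain ⟨-, rfl⟩ := exp_D_unique k h2
    rfl

theorem perceives_E (k : Type w) [CommRing k] [AlgebraObj k R] [KockLawvere k R]
    (T : C) (a b : T ⊗ Dpow R 2 ∅ ⟶ R) (hab : T ◁ inclD2 ≫ a = T ◁ inclD2 ≫ b) :
    ∃! h : T ⊗ Dpow R 3 {(0, 2), (1, 2)} ⟶ R, T ◁ j₁ ≫ h = a ∧ T ◁ j₂ ≫ h = b := by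
  obtain ⟨a0, a1, a2, a3, rfl⟩ := exp_DD k a
  obtain ⟨b0, b1, b2, b3, rfl⟩ := exp_DD k b
  have hz : (snd T (Dpow R 2 {(0, 1)}) ≫ Dpow.coord 0) * (snd T (Dpow R 2 {(0, 1)}) ≫ Dpow.coord 1)
      = 0 := by
    rw [← MonObj.comp_mul, Dpow.coord_mul _ _ (by decide), AddMonObj.comp_zero]
  simp [inclD2, AddMonObj.comp_add, MonObj.comp_mul, hz] at hab
  obtain ⟨rfl, rfl, rfl⟩ := exp_D2_unique k hab
  refine ⟨fst _ _ ≫ a0 + (fst _ _ ≫ a1) * (snd _ _ ≫ Dpow.coord 0)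
      + (fst _ _ ≫ a2) * (snd _ _ ≫ Dpow.coord 1)
      + (fst _ _ ≫ b3) * ((snd _ _ ≫ Dpow.coord 0) * (snd _ _ ≫ Dpow.coord 1))
      + (fst _ _ ≫ (a3 - b3)) * (snd _ _ ≫ Dpow.coord 2), ?_, ?_⟩
  · have hs : fst T (Dpow R 2 ∅) ≫ (a3 - b3) = fst _ _ ≫ a3 - fst _ _ ≫ b3 :=
      map_sub (restr (fst T (Dpow R 2 ∅))) a3 b3
    simp [j₁, j₂, AddMonObj.comp_add, MonObj.comp_mul, AddMonObj.comp_zero, hs]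
    ring
  · rintro h ⟨h1, h2⟩
    obtain ⟨e0, e1, e2, e3, e4, rfl⟩ := exp_E k h
    simp [j₁, j₂, AddMonObj.comp_add, MonObj.comp_mul, AddMonObj.comp_zero] at h1 h2
    obtain ⟨rfl, rfl, rfl, rfl⟩ := exp_DD_unique k h2
    rw [add_assoc, ← add_mul, ← AddMonObj.comp_add] at h1
    obtain ⟨-, -, -, rfl⟩ := exp_DD_unique k h1
    rw [add_sub_cancel_left]

end Perc

end Concrete

section VectorFields
variable {C : Type u} [Category.{v} C] [CartesianMonoidalCategory C] [BraidedCategory C]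
  [HasFiniteLimits C]

section Operations
variable {R : C} [CommRingObj R] {M T : C}

/-- Two tangent vectors with the same base point extend to a unique map on `D(2)`. -/
theorem exists_unique_sum (k : Type w) [CommRing k] [AlgebraObj k R] [KockLawvere k R]
    [Microlinear k R M] (t₁ t₂ : T ⊗ Dpow R 1 ∅ ⟶ M)
    (h : lift (𝟙 T) Dpow.zero ≫ t₁ = lift (𝟙 T) Dpow.zero ≫ t₂) :
    ∃! l : T ⊗ Dpow R 2 {(0, 1)} ⟶ M, T ◁ axis₁ ≫ l = t₁ ∧ T ◁ axis₂ ≫ l = t₂ := by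
  refine exists_unique_glue k R (Dpow.zero : Dpow R 0 ∅ ⟶ Dpow R 1 ∅) Dpow.zero axis₁ axis₂ ?_
    (isSmall_Dpow k _) (isSmall_Dpow k _) (isSmall_Dpow k _) (isSmall_Dpow k _)
    (perceives_D2 k) T t₁ t₂ ?_
  · apply Dpow.hom_ext
    intro i
    fin_cases i <;> simp [axis₁, axis₂, Dpow.zero, AddMonObj.comp_zero]
  · have e : T ◁ (Dpow.zero : Dpow R 0 ∅ ⟶ Dpow R 1 ∅) =
        fst T (Dpow R 0 ∅) ≫ lift (𝟙 T) Dpow.zero := by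
      ext <;> simp
    rw [e, Category.assoc, Category.assoc, h]

/-- The sum of two tangent vectors `t₁, t₂ : D → M` with the same base point: `d ↦ l (d, d)`, where
`l : D(2) → M` is the unique map with `l (d, 0) = t₁ d` and `l (0, d) = t₂ d`. -/
def tangentSum (k : Type w) [CommRing k] [AlgebraObj k R] [KockLawvere k R]
    [Microlinear k R M] (t₁ t₂ : T ⊗ Dpow R 1 ∅ ⟶ M)
    (h : lift (𝟙 T) Dpow.zero ≫ t₁ = lift (𝟙 T) Dpow.zero ≫ t₂) : T ⊗ Dpow R 1 ∅ ⟶ M :=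
  T ◁ diag ≫ (exists_unique_sum k t₁ t₂ h).choose

/-- Two microsquares that agree on `D(2)` extend to a unique map on `D³{(1,3),(2,3)}`. -/
theorem exists_unique_strongDiff (k : Type w) [CommRing k] [AlgebraObj k R] [KockLawvere k R]
    [Microlinear k R M] (γ₁ γ₂ : T ⊗ Dpow R 2 ∅ ⟶ M)
    (h : T ◁ inclD2 ≫ γ₁ = T ◁ inclD2 ≫ γ₂) :
    ∃! n : T ⊗ Dpow R 3 {(0, 2), (1, 2)} ⟶ M, T ◁ j₁ ≫ n = γ₁ ∧ T ◁ j₂ ≫ n = γ₂ := by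
  refine exists_unique_glue k R inclD2 inclD2 j₁ j₂ ?_
    (isSmall_Dpow k _) (isSmall_Dpow k _) (isSmall_Dpow k _) (isSmall_Dpow k _)
    (perceives_E k) T γ₁ γ₂ h
  have hz : Dpow.coord (R := R) (p := {(0, 1)}) (0 : Fin 2) * Dpow.coord 1 = 0 :=
    Dpow.coord_mul _ _ (by decide)
  apply Dpow.hom_ext
  intro i
  fin_cases i <;> simp [inclD2, j₁, j₂, MonObj.comp_mul, AddMonObj.comp_zero, hz]

/-- The strong difference of two microsquares `γ₁, γ₂ : D² → M` that agree on `D(2)`: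
`d ↦ n (0, 0, d)`, where `n : D³{(1,3),(2,3)} → M` is the unique map with
`n (d₁, d₂, d₁ d₂) = γ₁ (d₁, d₂)` and `n (d₁, d₂, 0) = γ₂ (d₁, d₂)`. -/
def strongDiff (k : Type w) [CommRing k] [AlgebraObj k R] [KockLawvere k R]
    [Microlinear k R M] (γ₁ γ₂ : T ⊗ Dpow R 2 ∅ ⟶ M) (h : T ◁ inclD2 ≫ γ₁ = T ◁ inclD2 ≫ γ₂) :
    T ⊗ Dpow R 1 ∅ ⟶ M :=
  T ◁ axis₃ ≫ (exists_unique_strongDiff k γ₁ γ₂ h).choose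

end Operations

/-- A vector field on `M` at stage `A`: a map `d ∈ D ↦ X_d ∈ M ^ M` with `X_0 = id`, in the form
`flow (a, m, d) = X_d (m)`. The vector fields in the ordinary sense are those at stage `𝟙_ C`; the
parameter `a : A` makes `X` an arbitrary generalized element of the object of vector fields.
The ring `k` is carried along only as a label for the operations below. -/
@[ext]
structure VectorField (k : Type w) (R : C) [CommRingObj R] (M A : C) where
  /-- `(a, m, d) ↦ X_d (m)` -/
  flow : (A ⊗ M) ⊗ Dpow R 1 ∅ ⟶ M
  flow_zero : lift (𝟙 (A ⊗ M)) Dpow.zero ≫ flow = snd A M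

/-- The `i`-th coordinate `Dⁿ{p} → D`. -/
def Dpow.pr {R : C} [CommRingObj R] {n : ℕ} {p : Finset (Fin n × Fin n)} (i : Fin n) :
    Dpow R n p ⟶ Dpow R 1 ∅ :=
  Dpow.mk (fun _ => Dpow.coord i) (fun _ _ _ => Dpow.coord_self i)

/-- `(d₁, d₂) ∈ D² ↦ (d₂, d₁) ∈ D²`. -/
def swap {R : C} [CommRingObj R] : Dpow R 2 ∅ ⟶ Dpow R 2 ∅ :=
  Dpow.mk ![Dpow.coord 1, Dpow.coord 0] (by
    intro i j h
    fin_cases i <;> fin_cases j <;> simp [killed, Dpow.coord_self] at h ⊢)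

namespace VectorField
variable {k : Type w} {R : C} [CommRingObj R] {M A : C}

/-- The point `X_d (m)`, for elements `a`, `d`, `m` at stage `T`. -/
def act (X : VectorField k R M A) {T : C} (a : T ⟶ A) (d : T ⟶ Dpow R 1 ∅) (m : T ⟶ M) : T ⟶ M :=
  lift (lift a m) d ≫ X.flow

theorem comp_act (X : VectorField k R M A) {T T' : C} (f : T' ⟶ T) (a : T ⟶ A)
    (d : T ⟶ Dpow R 1 ∅) (m : T ⟶ M) : f ≫ X.act a d m = X.act (f ≫ a) (f ≫ d) (f ≫ m) := by
  simp only [act, ← Category.assoc, comp_lift]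

theorem act_zero (X : VectorField k R M A) {T : C} (a : T ⟶ A) (m : T ⟶ M) :
    X.act a Dpow.zero m = m := by
  have e : lift (lift a m) (Dpow.zero : T ⟶ Dpow R 1 ∅) =
      lift a m ≫ lift (𝟙 (A ⊗ M)) Dpow.zero := by
    ext <;> simp
  rw [act, e, Category.assoc, X.flow_zero, lift_snd]

theorem act_univ (X : VectorField k R M A) :
    X.act (fst (A ⊗ M) _ ≫ fst A M) (snd _ _) (fst (A ⊗ M) _ ≫ snd A M) = X.flow := by
  have e : lift (lift (fst (A ⊗ M) (Dpow R 1 ∅) ≫ fst A M) (fst (A ⊗ M) _ ≫ snd A M))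
      (snd (A ⊗ M) (Dpow R 1 ∅)) = 𝟙 _ := by
    ext <;> simp
  rw [act, e, Category.id_comp]

/-- `Y ∗ X`, the map `(d₁, d₂) ∈ D² ↦ Y_{d₂} ∘ X_{d₁} ∈ M ^ M`. -/
def star (Y X : VectorField k R M A) : (A ⊗ M) ⊗ Dpow R 2 ∅ ⟶ M :=
  Y.act (fst _ _ ≫ fst _ _) (snd _ _ ≫ Dpow.pr 1)
    (X.act (fst _ _ ≫ fst _ _) (snd _ _ ≫ Dpow.pr 0) (fst _ _ ≫ snd _ _))

/-- The zero vector field, `d ↦ id`. -/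
instance : Zero (VectorField k R M A) where
  zero := ⟨fst _ _ ≫ snd _ _, by simp⟩

variable [CommRing k] [AlgebraObj k R] [KockLawvere k R] [Microlinear k R M]

/-- Vector fields are added as tangent vectors, pointwise. -/
instance : Add (VectorField k R M A) where
  add X Y :=
    { flow := tangentSum k X.flow Y.flow (X.flow_zero.trans Y.flow_zero.symm)
      flow_zero := by
        have h := (exists_unique_sum k X.flow Y.flow
          (X.flow_zero.trans Y.flow_zero.symm)).choose_spec.1.1
        have e : (Dpow.zero : A ⊗ M ⟶ Dpow R 1 ∅) ≫ diag = Dpow.zero ≫ axis₁ := by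
          apply Dpow.hom_ext
          intro i
          fin_cases i <;> simp [diag, axis₁, Dpow.zero, AddMonObj.comp_zero]
        rw [tangentSum, lift_whiskerLeft_assoc, e, ← lift_whiskerLeft_assoc, h, X.flow_zero] }

theorem star_compat (Y X : VectorField k R M A) :
    (A ⊗ M) ◁ inclD2 ≫ star Y X = (A ⊗ M) ◁ inclD2 ≫ (A ⊗ M) ◁ swap ≫ star X Y := by
  have p1 : (axis₁ ≫ inclD2) ≫ Dpow.pr 0 = 𝟙 (Dpow R 1 ∅) := Dpow.hom_ext fun i => by
    fin_cases i; simp [axis₁, inclD2, Dpow.pr]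
  have p2 : (axis₁ ≫ inclD2) ≫ Dpow.pr 1 = (Dpow.zero : Dpow R 1 ∅ ⟶ _) := Dpow.hom_ext fun i => by
    fin_cases i; simp [axis₁, inclD2, Dpow.pr, Dpow.zero]
  have p3 : (axis₂ ≫ inclD2) ≫ Dpow.pr 0 = (Dpow.zero : Dpow R 1 ∅ ⟶ _) := Dpow.hom_ext fun i => by
    fin_cases i; simp [axis₂, inclD2, Dpow.pr, Dpow.zero]
  have p4 : (axis₂ ≫ inclD2) ≫ Dpow.pr 1 = 𝟙 (Dpow R 1 ∅) := Dpow.hom_ext fun i => by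
    fin_cases i; simp [axis₂, inclD2, Dpow.pr]
  have s0 : swap ≫ Dpow.pr 0 = (Dpow.pr 1 : Dpow R 2 ∅ ⟶ _) := Dpow.hom_ext fun i => by
    fin_cases i; simp [swap, Dpow.pr]
  have s1 : swap ≫ Dpow.pr 1 = (Dpow.pr 0 : Dpow R 2 ∅ ⟶ _) := Dpow.hom_ext fun i => by
    fin_cases i; simp [swap, Dpow.pr]
  simp only [Category.assoc] at p1 p2 p3 p4
  refine (exists_unique_sum k X.flow Y.flow (X.flow_zero.trans Y.flow_zero.symm)).unique
    ⟨?_, ?_⟩ ⟨?_, ?_⟩ <;>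
  simp [star, comp_act, act_zero, act_univ, p1, p2, p3, p4, s0, s1]

/-- The Lie bracket `[X, Y]`: the strong difference of `Y ∗ X` and of `X ∗ Y` with its two
arguments exchanged, that is, of `(d₁, d₂) ↦ Y_{d₂} ∘ X_{d₁}` and `(d₁, d₂) ↦ X_{d₁} ∘ Y_{d₂}`. -/
instance : Bracket (VectorField k R M A) (VectorField k R M A) where
  bracket X Y :=
    { flow := strongDiff k (star Y X) ((A ⊗ M) ◁ swap ≫ star X Y) (star_compat Y X)
      flow_zero := by
        have h := (exists_unique_strongDiff k (star Y X) ((A ⊗ M) ◁ swap ≫ star X Y)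
          (star_compat Y X)).choose_spec.1.2
        have e : (Dpow.zero : A ⊗ M ⟶ Dpow R 1 ∅) ≫ axis₃ = Dpow.zero ≫ j₂ := by
          apply Dpow.hom_ext
          intro i
          fin_cases i <;> simp [j₂, axis₃, Dpow.zero, AddMonObj.comp_zero]
        have z (i : Fin 2) : (Dpow.zero : A ⊗ M ⟶ Dpow R 2 ∅) ≫ swap ≫ Dpow.pr i = Dpow.zero :=
          Dpow.hom_ext fun j => by
            fin_cases i <;> simp [swap, Dpow.pr, Dpow.zero]
        rw [strongDiff, lift_whiskerLeft_assoc, e, ← lift_whiskerLeft_assoc, h]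
        simp [star, comp_act, act_zero, z] }

end VectorField

end VectorFields

end

end SDG

/-!
Write `X_d` for the infinitesimal transformation of `M` attached to a vector field `X` and `d ∈ D`.
By microlinearity, maps on `D(2)` are determined by their restrictions to the two axes; hence `X_d`
is invertible, with inverse `X_{-d}`, and `X_d`, `Y_e` commute when `d e = 0`. Microlinearity for
`D³{(1,3),(2,3)}`, seen as the wedge of `D²` and `D`, identifies the map defining the strong
difference with `(d₁, d₂, d₃) ↦ X_{d₁} Y_{d₂} [X, Y]_{d₃}`, so `[X, Y]_{d e}` is the group
commutator `Y_e X_d Y_e⁻¹ X_d⁻¹`.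

A map `D → M` is determined by its values at products `d e`, hence also by its values at triple
products `d e f`. At `d e f` the Jacobi identity becomes the Hall–Witt identity: the conjugations
occurring there are trivial because `d² = e² = f² = 0`. The twelve iterated brackets of four vector
fields are the brackets of each field with the Jacobi sum of the other three.
-/

namespace SDG

open scoped commutatorElement

theorem commutatorElement_mul_mul_eq_one {G : Type*} [Group G] {a b c : G}
    (ha : Commute a ⁅⁅a⁻¹, b⁆, c⁆) (hb : Commute b ⁅⁅b⁻¹, c⁆, a⁆) (hc : Commute c ⁅⁅c⁻¹, a⁆, b⁆) :
    ⁅⁅a⁻¹, b⁆, c⁆ * ⁅⁅c⁻¹, a⁆, b⁆ * ⁅⁅b⁻¹, c⁆, a⁆ = 1 := by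
  calc
    _ = a * ⁅⁅a⁻¹, b⁆, c⁆ * a⁻¹ * (c * ⁅⁅c⁻¹, a⁆, b⁆ * c⁻¹) * (b * ⁅⁅b⁻¹, c⁆, a⁆ * b⁻¹) := by
      rw [ha.mul_inv_cancel, hb.mul_inv_cancel, hc.mul_inv_cancel]
    _ = 1 := by
      simpa only [mul_assoc] using conj_commutatorElement_left_commutatorElement_mul a b c

noncomputable section

variable {C : Type u} [Category.{v} C] [CartesianMonoidalCategory C] [BraidedCategory C]
  [HasFiniteLimits C] {R : C} [CommRingObj R]

namespace Dpow

section Elements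

variable {S T : C}

theorem coord_mul_coord (d : T ⟶ Dpow R 1 ∅) : (d ≫ coord 0) * (d ≫ coord 0) = 0 := by
  rw [← MonObj.comp_mul, coord_self, AddMonObj.comp_zero]

theorem coord_injective :
    Function.Injective fun d : T ⟶ Dpow R 1 ∅ => d ≫ coord 0 :=
  fun d e h => hom_ext fun i => by rwa [Subsingleton.elim i 0]

instance : Zero (T ⟶ Dpow R 1 ∅) := ⟨zero⟩

instance : Mul (T ⟶ Dpow R 1 ∅) where
  mul d e := mk (fun _ => (d ≫ coord 0) * (e ≫ coord 0)) fun _ _ _ => by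
    rw [mul_mul_mul_comm, coord_mul_coord, zero_mul]

instance : Neg (T ⟶ Dpow R 1 ∅) where
  neg d := mk (fun _ => -(d ≫ coord 0)) fun _ _ _ => by rw [neg_mul_neg, coord_mul_coord]

theorem zero_coord : (0 : T ⟶ Dpow R 1 ∅) ≫ coord 0 = 0 :=
  mk_coord (fun _ => 0) (by simp) 0

theorem mul_coord (d e : T ⟶ Dpow R 1 ∅) :
    (d * e) ≫ coord 0 = (d ≫ coord 0) * (e ≫ coord 0) := mk_coord _ _ _

theorem neg_coord (d : T ⟶ Dpow R 1 ∅) : (-d) ≫ coord 0 = -(d ≫ coord 0) := mk_coord _ _ _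

instance : CommSemigroup (T ⟶ Dpow R 1 ∅) := coord_injective.commSemigroup _ mul_coord

instance : MulZeroClass (T ⟶ Dpow R 1 ∅) := coord_injective.mulZeroClass _ zero_coord mul_coord

instance : HasDistribNeg (T ⟶ Dpow R 1 ∅) := coord_injective.hasDistribNeg _ neg_coord mul_coord

theorem mul_self (d : T ⟶ Dpow R 1 ∅) : d * d = 0 :=
  coord_injective <| by simp only [mul_coord, coord_mul_coord, zero_coord]

theorem comp_mul (f : S ⟶ T) (d e : T ⟶ Dpow R 1 ∅) : f ≫ (d * e) = (f ≫ d) * (f ≫ e) :=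
  coord_injective <| by simp only [Category.assoc, mul_coord, MonObj.comp_mul]

theorem comp_neg (f : S ⟶ T) (d : T ⟶ Dpow R 1 ∅) : f ≫ (-d) = -(f ≫ d) :=
  coord_injective <| by
    simp only [Category.assoc, neg_coord]
    exact map_neg (restr f) _

end Elements

section Coordinates

variable {T : C} {n : ℕ} {p : Finset (Fin n × Fin n)}

@[simp] theorem pr_coord (i : Fin n) :
    (pr i : Dpow R n p ⟶ Dpow R 1 ∅) ≫ coord 0 = coord i := mk_coord _ _ _

@[simp] theorem zero_pr (i : Fin n) : (zero : T ⟶ Dpow R n p) ≫ pr i = zero :=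
  coord_injective <| by simp [zero]

theorem hom_ext_pr {f g : T ⟶ Dpow R n p} (h : ∀ i, f ≫ pr i = g ≫ pr i) : f = g :=
  hom_ext fun i => by simpa using h i =≫ coord 0

/-- The element of `Dⁿ{p}` with given coordinates in `D`; unlike for `mk`, only the relations in
`p` have to be checked. -/
def ofPr (d : Fin n → (T ⟶ Dpow R 1 ∅)) (h : ∀ i j, (i, j) ∈ p → d i * d j = 0) :
    T ⟶ Dpow R n p :=
  mk (fun i => d i ≫ coord 0) <| by
    rintro i j (hij | hij)
    · obtain rfl : i = j := hij
      exact coord_mul_coord (d i)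
    · rw [← mul_coord, h i j hij, zero_coord]

@[simp] theorem ofPr_pr (d : Fin n → (T ⟶ Dpow R 1 ∅)) (h : ∀ i j, (i, j) ∈ p → d i * d j = 0)
    (i : Fin n) : ofPr d h ≫ pr i = d i :=
  coord_injective <| by simp [ofPr]

theorem pr_mul_pr {i j : Fin n} (h : (i, j) ∈ p) :
    (pr i * pr j : Dpow R n p ⟶ Dpow R 1 ∅) = zero :=
  coord_injective <| by simp [mul_coord, coord_mul i j (.inr h), zero]

end Coordinates

section Maps

@[simp] theorem inclD2_pr (i : Fin 2) : inclD2 ≫ pr (R := R) i = pr i :=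
  coord_injective <| by fin_cases i <;> simp [inclD2]

@[simp] theorem swap_pr_zero : swap ≫ pr (R := R) 0 = pr 1 := coord_injective <| by simp [swap]

@[simp] theorem swap_pr_one : swap ≫ pr (R := R) 1 = pr 0 := coord_injective <| by simp [swap]

@[simp] theorem axis₁_pr_zero : axis₁ ≫ pr (R := R) 0 = 𝟙 _ := coord_injective <| by simp [axis₁]

@[simp] theorem axis₁_pr_one : axis₁ ≫ pr (R := R) 1 = zero :=
  coord_injective <| by simp [axis₁, zero]

@[simp] theorem axis₂_pr_zero : axis₂ ≫ pr (R := R) 0 = zero :=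
  coord_injective <| by simp [axis₂, zero]

@[simp] theorem axis₂_pr_one : axis₂ ≫ pr (R := R) 1 = 𝟙 _ := coord_injective <| by simp [axis₂]

@[simp] theorem diag_pr (i : Fin 2) : diag ≫ pr (R := R) i = 𝟙 _ :=
  coord_injective <| by fin_cases i <;> simp [diag]

@[simp] theorem j₁_pr_zero : j₁ ≫ pr (R := R) 0 = pr 0 := coord_injective <| by simp [j₁]

@[simp] theorem j₁_pr_one : j₁ ≫ pr (R := R) 1 = pr 1 := coord_injective <| by simp [j₁]

@[simp] theorem j₁_pr_two : j₁ ≫ pr (R := R) 2 = pr 0 * pr 1 :=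
  coord_injective <| by simp [j₁, mul_coord]

@[simp] theorem j₂_pr_zero : j₂ ≫ pr (R := R) 0 = pr 0 := coord_injective <| by simp [j₂]

@[simp] theorem j₂_pr_one : j₂ ≫ pr (R := R) 1 = pr 1 := coord_injective <| by simp [j₂]

@[simp] theorem j₂_pr_two : j₂ ≫ pr (R := R) 2 = zero :=
  coord_injective <| by simp [j₂, zero]

@[simp] theorem axis₃_pr_zero : axis₃ ≫ pr (R := R) 0 = zero :=
  coord_injective <| by simp [axis₃, zero]

@[simp] theorem axis₃_pr_one : axis₃ ≫ pr (R := R) 1 = zero :=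
  coord_injective <| by simp [axis₃, zero]

@[simp] theorem axis₃_pr_two : axis₃ ≫ pr (R := R) 2 = 𝟙 _ := coord_injective <| by simp [axis₃]

/-- Addition `(d₁, d₂) ∈ D(2) ↦ d₁ + d₂ ∈ D`; it is not defined on all of `D²`, where
`(d₁ + d₂)² = 2 d₁ d₂` need not vanish. -/
def add : Dpow R 2 {(0, 1)} ⟶ Dpow R 1 ∅ :=
  mk (fun _ => coord 0 + coord 1) fun _ _ _ => by
    linear_combination coord_self (R := R) (p := {(0, 1)}) (0 : Fin 2) +
      coord_self (R := R) (p := {(0, 1)}) (1 : Fin 2) +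
      2 * coord_mul (R := R) (p := {(0, 1)}) (0 : Fin 2) 1 (by decide)

theorem add_coord :
    (add : Dpow R 2 {(0, 1)} ⟶ Dpow R 1 ∅) ≫ coord 0 = coord 0 + coord 1 := mk_coord _ _ _

@[simp] theorem axis₁_add : axis₁ ≫ (add : _ ⟶ Dpow R 1 ∅) = 𝟙 _ :=
  coord_injective <| by simp [axis₁, add_coord, AddMonObj.comp_add]

@[simp] theorem axis₂_add : axis₂ ≫ (add : _ ⟶ Dpow R 1 ∅) = 𝟙 _ :=
  coord_injective <| by simp [axis₂, add_coord, AddMonObj.comp_add]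

end Maps

end Dpow

section Extension

theorem perceives_wedge (k : Type w) [CommRing k] [AlgebraObj k R] [KockLawvere k R] (T : C)
    (a : T ⊗ Dpow R 2 ∅ ⟶ R) (b : T ⊗ Dpow R 1 ∅ ⟶ R)
    (hab : T ◁ (Dpow.zero : Dpow R 0 ∅ ⟶ Dpow R 2 ∅) ≫ a = T ◁ Dpow.zero ≫ b) :
    ∃! h : T ⊗ Dpow R 3 {(0, 2), (1, 2)} ⟶ R, T ◁ j₂ ≫ h = a ∧ T ◁ axis₃ ≫ h = b := by
  obtain ⟨a₀, a₁, a₂, a₁₂, rfl⟩ := exp_DD k a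
  obtain ⟨b₀, b₁, rfl⟩ := exp_D k b
  obtain rfl : a₀ = b₀ := by
    simpa [Dpow.zero, AddMonObj.comp_add, MonObj.comp_mul, AddMonObj.comp_zero]
      using lift (𝟙 T) Dpow.zero ≫= hab
  refine ⟨fst _ _ ≫ a₀ + (fst _ _ ≫ a₁) * (snd _ _ ≫ Dpow.coord 0)
      + (fst _ _ ≫ a₂) * (snd _ _ ≫ Dpow.coord 1)
      + (fst _ _ ≫ a₁₂) * ((snd _ _ ≫ Dpow.coord 0) * (snd _ _ ≫ Dpow.coord 1))
      + (fst _ _ ≫ b₁) * (snd _ _ ≫ Dpow.coord 2), ?_, ?_⟩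
  · simp [j₂, axis₃, AddMonObj.comp_add, MonObj.comp_mul, AddMonObj.comp_zero]
  · rintro h ⟨hj, hx⟩
    obtain ⟨c₀, c₁, c₂, c₁₂, c₃, rfl⟩ := exp_E k h
    obtain ⟨rfl, rfl, rfl, rfl⟩ := exp_DD_unique k (by
      simpa [j₂, AddMonObj.comp_add, MonObj.comp_mul, AddMonObj.comp_zero] using hj)
    obtain ⟨-, rfl⟩ := exp_D_unique k (a := c₀) (b := c₃) (a' := c₀) (b' := b₁) (by
      simpa [axis₃, AddMonObj.comp_add, MonObj.comp_mul, AddMonObj.comp_zero] using hx)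
    rfl

variable {M T : C}

theorem hom_ext_axes (k : Type w) [CommRing k] [AlgebraObj k R] [KockLawvere k R]
    [Microlinear k R M] {f g : T ⊗ Dpow R 2 {(0, 1)} ⟶ M}
    (h₁ : T ◁ axis₁ ≫ f = T ◁ axis₁ ≫ g) (h₂ : T ◁ axis₂ ≫ f = T ◁ axis₂ ≫ g) : f = g := by
  have origin : (Dpow.zero : T ⟶ Dpow R 1 ∅) ≫ axis₁ = Dpow.zero ≫ axis₂ :=
    Dpow.hom_ext_pr fun i => by fin_cases i <;> simp
  refine (exists_unique_sum k _ _ ?_).unique ⟨h₁, h₂⟩ ⟨rfl, rfl⟩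
  rw [lift_whiskerLeft_assoc, lift_whiskerLeft_assoc, origin]

theorem hom_ext_microsquares (k : Type w) [CommRing k] [AlgebraObj k R] [KockLawvere k R]
    [Microlinear k R M] {f g : T ⊗ Dpow R 3 {(0, 2), (1, 2)} ⟶ M}
    (h₁ : T ◁ j₁ ≫ f = T ◁ j₁ ≫ g) (h₂ : T ◁ j₂ ≫ f = T ◁ j₂ ≫ g) : f = g := by
  have overlap : inclD2 ≫ j₁ = (inclD2 : _ ⟶ Dpow R 2 ∅) ≫ j₂ :=
    Dpow.hom_ext_pr fun i => by fin_cases i <;> simp [Dpow.comp_mul, Dpow.pr_mul_pr]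
  refine (exists_unique_strongDiff k _ _ ?_).unique ⟨h₁, h₂⟩ ⟨rfl, rfl⟩
  simp only [← MonoidalCategory.whiskerLeft_comp_assoc, overlap]

theorem hom_ext_wedge (k : Type w) [CommRing k] [AlgebraObj k R] [KockLawvere k R]
    [Microlinear k R M] {f g : T ⊗ Dpow R 3 {(0, 2), (1, 2)} ⟶ M}
    (h₂ : T ◁ j₂ ≫ f = T ◁ j₂ ≫ g) (h₃ : T ◁ axis₃ ≫ f = T ◁ axis₃ ≫ g) : f = g := by
  have origin : (Dpow.zero : Dpow R 0 ∅ ⟶ Dpow R 2 ∅) ≫ j₂ = Dpow.zero ≫ axis₃ :=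
    Dpow.hom_ext_pr fun i => by fin_cases i <;> simp
  refine (exists_unique_glue k R _ _ j₂ axis₃ origin (isSmall_Dpow k _) (isSmall_Dpow k _)
    (isSmall_Dpow k _) (isSmall_Dpow k _) (perceives_wedge k) T _ _ ?_).unique
    ⟨h₂, h₃⟩ ⟨rfl, rfl⟩
  simp only [← MonoidalCategory.whiskerLeft_comp_assoc, origin]

/- Pull back along `pr 2`, whose composites with `j₁` and `j₂` take products as values and of which
`axis₃` is a section. -/
theorem hom_ext_mul (k : Type w) [CommRing k] [AlgebraObj k R] [KockLawvere k R]
    [Microlinear k R M] {f g : T ⊗ Dpow R 1 ∅ ⟶ M}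
    (h : ∀ {S : C} (s : S ⟶ T) (d e : S ⟶ Dpow R 1 ∅),
      lift s (d * e) ≫ f = lift s (d * e) ≫ g) : f = g := by
  have lifted : T ◁ Dpow.pr 2 ≫ f = T ◁ (Dpow.pr 2 : Dpow R 3 {(0, 2), (1, 2)} ⟶ _) ≫ g := by
    have agree_along (u : Dpow R 2 ∅ ⟶ Dpow R 3 {(0, 2), (1, 2)}) (d e : Dpow R 2 ∅ ⟶ Dpow R 1 ∅)
        (hu : u ≫ Dpow.pr 2 = d * e) :
        T ◁ u ≫ T ◁ Dpow.pr 2 ≫ f = T ◁ u ≫ T ◁ Dpow.pr 2 ≫ g := by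
      have whiskered : T ◁ (d * e) = lift (fst _ _) ((snd _ _ ≫ d) * (snd _ _ ≫ e)) := by
        rw [← Dpow.comp_mul]
        ext <;> simp
      simp only [← MonoidalCategory.whiskerLeft_comp_assoc, hu, whiskered, h]
    exact hom_ext_microsquares k (agree_along j₁ _ _ Dpow.j₁_pr_two)
      (agree_along j₂ 0 0 (Dpow.j₂_pr_two.trans (mul_zero _).symm))
  simpa [← MonoidalCategory.whiskerLeft_comp_assoc] using T ◁ axis₃ ≫= lifted

theorem hom_ext_mul_mul (k : Type w) [CommRing k] [AlgebraObj k R] [KockLawvere k R]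
    [Microlinear k R M] {f g : T ⊗ Dpow R 1 ∅ ⟶ M}
    (h : ∀ {S : C} (s : S ⟶ T) (c d e : S ⟶ Dpow R 1 ∅),
      lift s (c * (d * e)) ≫ f = lift s (c * (d * e)) ≫ g) : f = g := by
  refine hom_ext_mul k fun {S} s c d => ?_
  have scaled (F : T ⊗ Dpow R 1 ∅ ⟶ M) {U : C} (u : U ⟶ S) (d : U ⟶ Dpow R 1 ∅) :
      lift u d ≫ lift (fst _ _ ≫ s) ((fst _ _ ≫ c) * snd _ _) ≫ F =
        lift (u ≫ s) ((u ≫ c) * d) ≫ F := by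
    simp [comp_lift_assoc, Dpow.comp_mul]
  have family : lift (fst S (Dpow R 1 ∅) ≫ s) ((fst _ _ ≫ c) * snd _ _) ≫ f =
      lift (fst S (Dpow R 1 ∅) ≫ s) ((fst _ _ ≫ c) * snd _ _) ≫ g :=
    hom_ext_mul k fun u d e => by rw [scaled, scaled, h]
  simpa [scaled] using lift (𝟙 S) d ≫= family

end Extension

namespace VectorField

variable {k : Type w} {M A : C}

section Act

variable {T : C} (a : T ⟶ A) (d : T ⟶ Dpow R 1 ∅) (m : T ⟶ M)

theorem act_fst_snd (X : VectorField k R M A) (s : T ⟶ A ⊗ M) :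
    X.act (s ≫ fst A M) d (s ≫ snd A M) = lift s d ≫ X.flow := by
  have : lift (s ≫ fst A M) (s ≫ snd A M) = s := by ext <;> simp
  rw [act, this]

theorem zero_act : (0 : VectorField k R M A).act a d m = m := by
  change lift (lift a m) d ≫ fst _ _ ≫ snd _ _ = m
  simp only [lift_fst_assoc, lift_snd]

theorem lift_star (X Y : VectorField k R M A) (d : T ⟶ Dpow R 2 ∅) :
    lift (lift a m) d ≫ star Y X = Y.act a (d ≫ Dpow.pr 1) (X.act a (d ≫ Dpow.pr 0) m) := by
  simp [star, comp_act]

/-- The vector field `d ↦ X_{-d}`. -/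
instance : Neg (VectorField k R M A) where
  neg X :=
    { flow := X.act (fst _ _ ≫ fst _ _) (-snd _ _) (fst _ _ ≫ snd _ _)
      flow_zero := by
        have neg_zero : -(Dpow.zero : A ⊗ M ⟶ Dpow R 1 ∅) = Dpow.zero :=
          Dpow.coord_injective <| by simp [Dpow.neg_coord, Dpow.zero]
        simp [comp_act, Dpow.comp_neg, neg_zero, act_zero] }

theorem neg_act (X : VectorField k R M A) : (-X).act a d m = X.act a (-d) m := by
  change lift (lift a m) d ≫ X.act _ _ _ = _
  simp [comp_act, Dpow.comp_neg]

/-- The map `(d₁, d₂, d₃) ↦ X_{d₁} ∘ Y_{d₂} ∘ Z_{d₃}` on `D³{(1,3),(2,3)}`. -/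
def tripleComp (X Y Z : VectorField k R M A) : (A ⊗ M) ⊗ Dpow R 3 {(0, 2), (1, 2)} ⟶ M :=
  X.act (fst _ _ ≫ fst _ _) (snd _ _ ≫ Dpow.pr 0)
    (Y.act (fst _ _ ≫ fst _ _) (snd _ _ ≫ Dpow.pr 1)
      (Z.act (fst _ _ ≫ fst _ _) (snd _ _ ≫ Dpow.pr 2) (fst _ _ ≫ snd _ _)))

theorem lift_tripleComp (X Y Z : VectorField k R M A) (d : T ⟶ Dpow R 3 {(0, 2), (1, 2)}) :
    lift (lift a m) d ≫ tripleComp X Y Z = X.act a (d ≫ Dpow.pr 0)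
      (Y.act a (d ≫ Dpow.pr 1) (Z.act a (d ≫ Dpow.pr 2) m)) := by
  simp [tripleComp, comp_act]

theorem j₂_tripleComp (X Y Z : VectorField k R M A) :
    (A ⊗ M) ◁ j₂ ≫ tripleComp X Y Z = (A ⊗ M) ◁ swap ≫ star X Y := by
  simp [tripleComp, star, comp_act, act_zero]

theorem axis₃_tripleComp (X Y Z : VectorField k R M A) :
    (A ⊗ M) ◁ axis₃ ≫ tripleComp X Y Z = Z.flow := by
  simp [tripleComp, comp_act, act_zero, act_univ]

end Act

variable [CommRing k] [AlgebraObj k R] [KockLawvere k R] [Microlinear k R M]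

section Act

variable {T : C} (a : T ⟶ A) (m : T ⟶ M)

theorem act_add (X : VectorField k R M A) (d : T ⟶ Dpow R 2 {(0, 1)}) :
    X.act a (d ≫ Dpow.add) m = X.act a (d ≫ Dpow.pr 0) (X.act a (d ≫ Dpow.pr 1) m) := by
  have universal : (A ⊗ M) ◁ Dpow.add ≫ X.flow =
      (A ⊗ M) ◁ inclD2 ≫ (A ⊗ M) ◁ swap ≫ star X X := by
    apply hom_ext_axes k <;> simp [← act_univ X, star, comp_act, act_zero]
  simpa [act, lift_star] using lift (lift a m) d ≫= universal

theorem act_act_comm (X Y : VectorField k R M A) (d e : T ⟶ Dpow R 1 ∅) (h : d * e = 0) :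
    X.act a d (Y.act a e m) = Y.act a e (X.act a d m) := by
  let p : T ⟶ Dpow R 2 {(0, 1)} := Dpow.ofPr ![d, e] (by simp [h])
  simpa [p, lift_star] using (lift (lift a m) p ≫= star_compat Y X).symm

theorem add_act (X Y : VectorField k R M A) (d : T ⟶ Dpow R 1 ∅) :
    (X + Y).act a d m = X.act a d (Y.act a d m) := by
  obtain ⟨h₁, h₂⟩ := (exists_unique_sum k X.flow Y.flow
    (X.flow_zero.trans Y.flow_zero.symm)).choose_spec.1
  have glued : _ = (A ⊗ M) ◁ inclD2 ≫ (A ⊗ M) ◁ swap ≫ star X Y :=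
    hom_ext_axes k (h₁.trans ?_) (h₂.trans ?_)
  · change lift (lift a m) d ≫ (A ⊗ M) ◁ diag ≫ _ = _
    rw [glued]
    simp [lift_star]
  all_goals simp [star, comp_act, act_zero, act_univ]

theorem act_act_bracket (X Y : VectorField k R M A) (d e : T ⟶ Dpow R 1 ∅) :
    X.act a d (Y.act a e (⁅X, Y⁆.act a (d * e) m)) = Y.act a e (X.act a d m) := by
  obtain ⟨h₁, h₂⟩ := (exists_unique_strongDiff k (star Y X) ((A ⊗ M) ◁ swap ≫ star X Y)
    (star_compat Y X)).choose_spec.1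
  have glued : _ = tripleComp X Y ⁅X, Y⁆ := hom_ext_wedge k
    (h₂.trans (j₂_tripleComp X Y ⁅X, Y⁆).symm) (axis₃_tripleComp X Y ⁅X, Y⁆).symm
  rw [glued] at h₁
  let p : T ⟶ Dpow R 2 ∅ := Dpow.ofPr ![d, e] (by simp)
  simpa [p, lift_tripleComp, lift_star, Dpow.comp_mul] using lift (lift a m) p ≫= h₁

end Act

section Perm

variable {T : C} (a : T ⟶ A)

theorem act_act_neg (X : VectorField k R M A) (d : T ⟶ Dpow R 1 ∅) (m : T ⟶ M) :
    X.act a d (X.act a (-d) m) = m := by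
  let p : T ⟶ Dpow R 2 {(0, 1)} := Dpow.ofPr ![d, -d] (by simp [Dpow.mul_self])
  have sum_zero : p ≫ Dpow.add = Dpow.zero := Dpow.coord_injective <| by
    simp [p, Dpow.add_coord, AddMonObj.comp_add, Dpow.ofPr, Dpow.zero, Dpow.neg_coord]
  simpa [p, sum_zero, act_zero] using (act_add a m X p).symm

/-- The infinitesimal transformation `X_d`, as a permutation of the elements of `M` at stage `T`. -/
def perm (X : VectorField k R M A) (d : T ⟶ Dpow R 1 ∅) : Equiv.Perm (T ⟶ M) where
  toFun := X.act a d
  invFun := X.act a (-d)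
  left_inv m := by simpa using X.act_act_neg a (-d) m
  right_inv := X.act_act_neg a d

theorem perm_neg (X : VectorField k R M A) (d : T ⟶ Dpow R 1 ∅) :
    X.perm a (-d) = (X.perm a d)⁻¹ :=
  Equiv.ext fun _ => rfl

theorem zero_perm (d : T ⟶ Dpow R 1 ∅) : (0 : VectorField k R M A).perm a d = 1 :=
  Equiv.ext (zero_act a d)

theorem neg_perm (X : VectorField k R M A) (d : T ⟶ Dpow R 1 ∅) :
    (-X).perm a d = (X.perm a d)⁻¹ :=
  Equiv.ext (X.neg_act a d)

theorem add_perm (X Y : VectorField k R M A) (d : T ⟶ Dpow R 1 ∅) :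
    (X + Y).perm a d = X.perm a d * Y.perm a d :=
  Equiv.ext fun m => add_act a m X Y d

theorem commute_perm (X Y : VectorField k R M A) {d e : T ⟶ Dpow R 1 ∅} (h : d * e = 0) :
    Commute (X.perm a d) (Y.perm a e) :=
  Equiv.ext fun m => act_act_comm a m X Y d e h

theorem bracket_perm (X Y : VectorField k R M A) (d e : T ⟶ Dpow R 1 ∅) :
    ⁅X, Y⁆.perm a (d * e) = ⁅Y.perm a e, X.perm a d⁆ := by
  have defining : X.perm a d * (Y.perm a e * ⁅X, Y⁆.perm a (d * e)) = Y.perm a e * X.perm a d :=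
    Equiv.ext fun m => act_act_bracket a m X Y d e
  have hX : Commute (X.perm a d) (⁅X, Y⁆.perm a (d * e)) :=
    commute_perm a _ _ (by rw [← mul_assoc, Dpow.mul_self, zero_mul])
  have hY : Commute (Y.perm a e) (⁅X, Y⁆.perm a (d * e)) :=
    commute_perm a _ _ (by rw [mul_left_comm, Dpow.mul_self, mul_zero])
  rw [commutatorElement_def, ← defining, hY.eq, ← mul_assoc, hX.eq]
  group

end Perm

theorem ext_perm {X Y : VectorField k R M A}
    (h : ∀ {T : C} (a : T ⟶ A) (d : T ⟶ Dpow R 1 ∅), X.perm a d = Y.perm a d) : X = Y := by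
  apply VectorField.ext
  rw [← act_univ X, ← act_univ Y]
  exact DFunLike.congr_fun (h _ _) _

theorem ext_perm_mul {X Y : VectorField k R M A}
    (h : ∀ {T : C} (a : T ⟶ A) (d e : T ⟶ Dpow R 1 ∅), X.perm a (d * e) = Y.perm a (d * e)) :
    X = Y := by
  refine VectorField.ext <| hom_ext_mul k fun s d e => ?_
  rw [← act_fst_snd, ← act_fst_snd]
  exact DFunLike.congr_fun (h _ d e) _

theorem ext_perm_mul_mul {X Y : VectorField k R M A}
    (h : ∀ {T : C} (a : T ⟶ A) (c d e : T ⟶ Dpow R 1 ∅),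
      X.perm a (c * (d * e)) = Y.perm a (c * (d * e))) : X = Y := by
  refine VectorField.ext <| hom_ext_mul_mul k fun s c d e => ?_
  rw [← act_fst_snd, ← act_fst_snd]
  exact DFunLike.congr_fun (h _ c d e) _

instance : AddCommGroup (VectorField k R M A) where
  add_assoc X Y Z := ext_perm fun a d => by simp only [add_perm, mul_assoc]
  zero_add X := ext_perm fun a d => by rw [add_perm, zero_perm, one_mul]
  add_zero X := ext_perm fun a d => by rw [add_perm, zero_perm, mul_one]
  add_comm X Y := ext_perm fun a d => by
    rw [add_perm, add_perm, (commute_perm a X Y (Dpow.mul_self d)).eq]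
  neg_add_cancel X := ext_perm fun a d => by
    rw [add_perm, neg_perm, zero_perm, inv_mul_cancel]
  nsmul := nsmulRec
  zsmul := zsmulRec

theorem bracket_add (X Y Z : VectorField k R M A) : ⁅X, Y + Z⁆ = ⁅X, Y⁆ + ⁅X, Z⁆ := by
  refine ext_perm_mul fun a d e => ?_
  have conj_eq : Y.perm a e * ⁅X, Z⁆.perm a (d * e) * (Y.perm a e)⁻¹ = ⁅X, Z⁆.perm a (d * e) :=
    (commute_perm a _ _ (by rw [mul_left_comm, Dpow.mul_self, mul_zero])).mul_inv_cancel
  rw [bracket_perm, add_perm, commutatorElement_mul_left_eq_conj_mul, ← bracket_perm,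
    ← bracket_perm, conj_eq, ← add_perm, add_comm]

theorem bracket_zero (X : VectorField k R M A) : ⁅X, (0 : VectorField k R M A)⁆ = 0 :=
  ext_perm_mul fun a d e => by rw [bracket_perm, zero_perm, zero_perm, commutatorElement_one_left]

theorem commutatorElement_perm_inv (X Y Z : VectorField k R M A) {T : C} (a : T ⟶ A)
    (d e f : T ⟶ Dpow R 1 ∅) :
    ⁅⁅(Z.perm a f)⁻¹, Y.perm a e⁆, X.perm a d⁆ = ⁅X, ⁅Y, Z⁆⁆.perm a (-(d * (e * f))) := by
  rw [← perm_neg, ← bracket_perm, ← bracket_perm, mul_neg, mul_neg]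

theorem commute_perm_commutatorElement (X Y Z : VectorField k R M A) {T : C} (a : T ⟶ A)
    (d e f : T ⟶ Dpow R 1 ∅) :
    Commute (Z.perm a f) ⁅⁅(Z.perm a f)⁻¹, Y.perm a e⁆, X.perm a d⁆ := by
  rw [commutatorElement_perm_inv]
  exact commute_perm a _ _ <| by
    rw [mul_neg, mul_left_comm, mul_left_comm f, Dpow.mul_self, mul_zero, mul_zero, neg_zero]

theorem jacobi (X Y Z : VectorField k R M A) :
    ⁅X, ⁅Y, Z⁆⁆ + ⁅Y, ⁅Z, X⁆⁆ + ⁅Z, ⁅X, Y⁆⁆ = 0 := by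
  refine ext_perm_mul_mul fun a d e f => ?_
  have cycle₁ : e * (f * d) = d * (e * f) := by rw [← mul_assoc, mul_comm]
  have cycle₂ : f * (d * e) = d * (e * f) := by rw [mul_comm, mul_assoc]
  have hallWitt := commutatorElement_mul_mul_eq_one (commute_perm_commutatorElement X Y Z a d e f)
    (commute_perm_commutatorElement Z X Y a f d e) (commute_perm_commutatorElement Y Z X a e f d)
  rw [commutatorElement_perm_inv, commutatorElement_perm_inv, commutatorElement_perm_inv, cycle₁,
    cycle₂, ← add_perm, ← add_perm, perm_neg, inv_eq_one] at hallWitt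
  rwa [zero_perm]

theorem bracket_jacobi (W X Y Z : VectorField k R M A) :
    ⁅W, ⁅X, ⁅Y, Z⁆⁆⁆ + ⁅W, ⁅Y, ⁅Z, X⁆⁆⁆ + ⁅W, ⁅Z, ⁅X, Y⁆⁆⁆ = 0 := by
  rw [← bracket_add, ← bracket_add, jacobi, bracket_zero]

end VectorField

end

end SDG

theorem mainTheorem4 {C : Type u} [Category.{v} C] [CartesianMonoidalCategory C]
    [BraidedCategory C] [HasFiniteLimits C]
    (k : Type w) [CommRing k] (R : C) [CommRingObj R] [SDG.AlgebraObj k R] [SDG.KockLawvere k R]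
    (M : C) [SDG.Microlinear k R M]
    (A : C) (X₁ X₂ X₃ X₄ : SDG.VectorField k R M A) :
    ⁅X₁, ⁅X₂, ⁅X₃, X₄⁆⁆⁆ + ⁅X₁, ⁅X₃, ⁅X₄, X₂⁆⁆⁆ + ⁅X₁, ⁅X₄, ⁅X₂, X₃⁆⁆⁆ +
    ⁅X₂, ⁅X₁, ⁅X₄, X₃⁆⁆⁆ + ⁅X₂, ⁅X₃, ⁅X₁, X₄⁆⁆⁆ + ⁅X₂, ⁅X₄, ⁅X₃, X₁⁆⁆⁆ +
    ⁅X₃, ⁅X₁, ⁅X₂, X₄⁆⁆⁆ + ⁅X₃, ⁅X₂, ⁅X₄, X₁⁆⁆⁆ + ⁅X₃, ⁅X₄, ⁅X₁, X₂⁆⁆⁆ +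
    ⁅X₄, ⁅X₁, ⁅X₃, X₂⁆⁆⁆ + ⁅X₄, ⁅X₂, ⁅X₁, X₃⁆⁆⁆ + ⁅X₄, ⁅X₃, ⁅X₂, X₁⁆⁆⁆ = 0 := by
  linear_combination (norm := abel) SDG.VectorField.bracket_jacobi X₁ X₂ X₃ X₄ +
    SDG.VectorField.bracket_jacobi X₂ X₁ X₄ X₃ + SDG.VectorField.bracket_jacobi X₃ X₁ X₂ X₄ +
    SDG.VectorField.bracket_jacobi X₄ X₁ X₃ X₂
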